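/- Let $d\ge 1$, let $f:\mathbb R^d\to\mathbb R$ be bounded and H\"older continuous, i.e. $|f(x)-f(y)|\le C|x-y|^\beta$ for all $x,y\in\mathbb R^d$, for some $C>0$ and $0<\beta\le 1$. Let $b:\mathbb R^d\to\mathbb R^d$ satisfy at least one of the following conditions: (i) there are $C>0$ and $0<\theta<1$ such that $|b(x)|\le C(1+|x|^\theta)$ and $|b(x)-b(y)|\le C|x-y|$ for all $x,y\in\mathbb R^d$; (ii) $b$ is continuous and $\langle b(x)-b(y),x-y\rangle\le 0$ for all $x,y\in\mathbb R^d$. Consider the problem $$u_t(t,x)=b(x)\cdot\nabla u(t,x)\ \text{ in }(0,\infty)\times\mathbb R^d,\qquad u(0,x)=f(x)\ \text{ on }\mathbb R^d. \tag{P}$$ An upper semicontinuous function $u:[0,\infty)\times\mathbb R^d\to\mathbb R$ that is bounded from above is a viscosity subsolution of (P) if $u(0,\cdot)\le f$ and $\varphi_t(t,x)-b(x)\cdot\nabla\varphi(t,x)\le 0$ whenever $\varphi\in C^1(\mathbb R^{d+1})$ and $\varphi-u$ attains its minimum over $(0,\infty)\times\mathbb R^d$ at $(t,x)\in(0,\infty)\times\mathbb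 R^d$. A lower semicontinuous function $u:[0,\infty)\times\mathbb R^d\to\mathbb R$ that is bounded from below is a viscosity supersolution of (P) if $u(0,\cdot)\ge f$ and $\varphi_t(t,x)-b(x)\cdot\nabla\varphi(t,x)\ge 0$ whenever $\varphi\in C^1(\mathbb R^{d+1})$ and $\varphi-u$ attains its maximum over $(0,\infty)\times\mathbb R^d$ at $(t,x)\in(0,\infty)\times\mathbb R^d$. A viscosity solution of (P) is a bounded continuous function on $[0,\infty)\times\mathbb R^d$ that is both a viscosity subsolution and a viscosity supersolution. Theorem. The problem (P) has exactly one viscosity solution $u$. Moreover, the system $$\frac{\mathrm d}{\mathrm dt}X(t;x)=b(X(t;x))\ \ (t\ge 0),\qquad X(0;x)=x,$$ has a solution $X(\cdot\,;x)$ on $[0,\infty)$ for every $x\in\mathbb R^d$, and for every such solution $$u(t,x)=f(X(t;x))\qquad\text{for all }(t,x)\in[0,\infty)\times\mathbb R^d.$$ -/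

import Mathlib

open Set
open scoped NNReal

noncomputable section

namespace Transport

/-- Points of `ℝ^d` with the Euclidean norm and scalar product. -/
abbrev E (d : ℕ) : Type := EuclideanSpace ℝ (Fin d)

variable {d : ℕ}

/-- `|f x - f y| ≤ C |x - y|^β` for some `C > 0` and some `0 < β ≤ 1`. -/
def SatisfiesHolder (f : E d → ℝ) : Prop :=
  ∃ C β : ℝ, 0 < C ∧ 0 < β ∧ β ≤ 1 ∧ ∀ x y : E d, |f x - f y| ≤ C * ‖x - y‖ ^ β

/-- Lipschitz vector fields with sublinear growth: `|b x| ≤ C (1 + |x|^θ)` and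
`|b x - b y| ≤ C |x - y|` for some `C > 0` and some `0 < θ < 1`. -/
def LipschitzSublinear (b : E d → E d) : Prop :=
  ∃ C θ : ℝ, 0 < C ∧ 0 < θ ∧ θ < 1 ∧
    (∀ x : E d, ‖b x‖ ≤ C * (1 + ‖x‖ ^ θ)) ∧
    ∀ x y : E d, ‖b x - b y‖ ≤ C * ‖x - y‖

/-- Continuous decreasing vector fields: `⟨b x - b y, x - y⟩ ≤ 0`. -/
def ContinuousDecreasing (b : E d → E d) : Prop :=
  Continuous b ∧ ∀ x y : E d, inner ℝ (b x - b y) (x - y) ≤ 0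

/-- The value `φ_t(t,x) - b(x) · ∇φ(t,x)` of the transport operator; the gradient is the one in
the space variable. -/
def transportOp (b : E d → E d) (φ : ℝ × E d → ℝ) (t : ℝ) (x : E d) : ℝ :=
  deriv (fun s : ℝ => φ (s, x)) t - inner ℝ (b x) (gradient (fun y : E d => φ (t, y)) x)

/-- The open time-space domain `(0,∞) × ℝ^d` as a subset of `[0,∞) × ℝ^d`. -/
def openDomain (d : ℕ) : Set (ℝ≥0 × E d) := {p | 0 < p.1}

/-- Viscosity subsolutions of `u_t = b · ∇u` in `(0,∞) × ℝ^d`, `u(0,·) = f`. -/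
structure IsViscositySubsolution (b : E d → E d) (f : E d → ℝ) (u : ℝ≥0 × E d → ℝ) : Prop where
  usc : UpperSemicontinuous u
  bddAbove : BddAbove (range u)
  test : ∀ φ : ℝ × E d → ℝ, ContDiff ℝ 1 φ → ∀ t : ℝ≥0, ∀ x : E d, 0 < t →
    IsMinOn (fun p : ℝ≥0 × E d => φ ((p.1 : ℝ), p.2) - u p) (openDomain d) (t, x) →
    transportOp b φ t x ≤ 0
  initial : ∀ x : E d, u (0, x) ≤ f x

/-- Viscosity supersolutions of `u_t = b · ∇u` in `(0,∞) × ℝ^d`, `u(0,·) = f`. -/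
structure IsViscositySupersolution (b : E d → E d) (f : E d → ℝ) (u : ℝ≥0 × E d → ℝ) : Prop where
  lsc : LowerSemicontinuous u
  bddBelow : BddBelow (range u)
  test : ∀ φ : ℝ × E d → ℝ, ContDiff ℝ 1 φ → ∀ t : ℝ≥0, ∀ x : E d, 0 < t →
    IsMaxOn (fun p : ℝ≥0 × E d => φ ((p.1 : ℝ), p.2) - u p) (openDomain d) (t, x) →
    0 ≤ transportOp b φ t x
  initial : ∀ x : E d, f x ≤ u (0, x)

/-- Viscosity solutions: bounded continuous functions that are both a viscosity subsolution and a
viscosity supersolution. -/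
structure IsViscositySolution (b : E d → E d) (f : E d → ℝ) (u : ℝ≥0 × E d → ℝ) : Prop where
  continuous : Continuous u
  bounded : ∃ M : ℝ, ∀ p, |u p| ≤ M
  sub : IsViscositySubsolution b f u
  super : IsViscositySupersolution b f u

/-- `X` solves `dX(t;x) = b(X(t;x)) dt`, `X(0;x) = x` on `[0,∞)`, for every starting point `x`
(the values of `X` at negative times play no role). -/
def IsFlow (b : E d → E d) (X : ℝ → E d → E d) : Prop :=
  ∀ x : E d, X 0 x = x ∧
    ∀ t : ℝ, 0 ≤ t → HasDerivWithinAt (fun s : ℝ => X s x) (b (X t x)) (Ici 0) t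

end Transport

end

noncomputable section

namespace Transport

open MeasureTheory Filter Topology

variable {d : ℕ}

/-! Both conditions on `b` yield continuity and `⟨b x - b y, x - y⟩ ≤ L |x - y|²` with some `L ≥ 0`.
This controls forward trajectories: a Gronwall estimate gives uniqueness and stability, and
solutions arise as limits for mollified fields with the same `L` (`exists_solvesOn`,
`exists_isFlow`).

The function `f (X t x)` is constant along the curves `h ↦ (t - h, X h x)`, and `φ_t - b · ∇φ` is
minus the derivative of `φ` along them at `h = 0`; hence it is a solution
(`IsFlow.isViscositySolution`). Conversely, let `Y` be a trajectory run backwards. The one-sided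
condition makes `e^{2|L|t} |x - Y t|²` a supersolution of the equation, so penalizing with it bounds
a subsolution on `Y` by `f (Y 0)` (`IsViscositySubsolution.le_of_characteristic`). Applying this to
`u` and to `-u` identifies every solution. -/

/-! ### Energy estimate and mollification -/

/-- One-sided Lipschitz condition `⟨b x - b y, x - y⟩ ≤ L |x - y|²`. -/
def OneSidedLipschitz (L : ℝ) (b : E d → E d) : Prop :=
  ∀ x y : E d, inner ℝ (b x - b y) (x - y) ≤ L * ‖x - y‖ ^ 2

/-- Gronwall estimate for a curve whose energy satisfies a one-sided differential inequality. -/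
theorem norm_sq_le_of_inner_deriv_le {Z Z' : ℝ → E d} {T L B : ℝ} (hL : 0 ≤ L)
    (hZ : ∀ t ∈ Icc 0 T, HasDerivWithinAt Z (Z' t) (Icc 0 T) t)
    (hin : ∀ t ∈ Icc 0 T, inner ℝ (Z' t) (Z t) ≤ L * ‖Z t‖ ^ 2 + B * ‖Z t‖)
    {t : ℝ} (ht : t ∈ Icc 0 T) :
    ‖Z t‖ ^ 2 ≤ Real.exp ((2 * L + 1) * t) * (‖Z 0‖ ^ 2 + B ^ 2 * t) := by
  -- The extra `1` absorbs the linear term: `2 B |Z| ≤ |Z|² + B²`.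
  set K := 2 * L + 1 with hK
  let g : ℝ → ℝ := fun s => Real.exp (-K * s) * ‖Z s‖ ^ 2 - B ^ 2 * s
  have hE : ∀ s, HasDerivAt (fun s : ℝ => Real.exp (-K * s)) (Real.exp (-K * s) * (-K)) s := by
    intro s
    simpa using ((hasDerivAt_id s).const_mul (-K)).exp
  have hg : ∀ s ∈ Icc 0 T, HasDerivWithinAt g
      (Real.exp (-K * s) * (-K) * ‖Z s‖ ^ 2
        + Real.exp (-K * s) * (2 * inner ℝ (Z s) (Z' s)) - B ^ 2) (Icc 0 T) s := by
    intro s hs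
    have h2 : HasDerivAt (fun s : ℝ => B ^ 2 * s) (B ^ 2) s := by
      simpa using (hasDerivAt_id s).const_mul (B ^ 2)
    exact ((hE s).hasDerivWithinAt.mul (hZ s hs).norm_sq).sub h2.hasDerivWithinAt
  have hanti : AntitoneOn g (Icc 0 T) := by
    apply antitoneOn_of_deriv_nonpos (convex_Icc 0 T)
      (fun s hs => (hg s hs).continuousWithinAt)
    · intro s hs
      exact ((hg s (interior_subset hs)).mono interior_subset).differentiableWithinAt
    · intro s hs
      have hs' := interior_subset hs
      rw [((hg s hs').hasDerivAt (mem_interior_iff_mem_nhds.mp hs)).deriv]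
      have h1 := hin s hs'
      rw [real_inner_comm] at h1
      have h2 : Real.exp (-K * s) * (-K * ‖Z s‖ ^ 2 + 2 * inner ℝ (Z s) (Z' s))
          ≤ Real.exp (-K * s) * B ^ 2 := by
        apply mul_le_mul_of_nonneg_left _ (Real.exp_pos _).le
        nlinarith [sq_nonneg (‖Z s‖ - B)]
      have h3 : Real.exp (-K * s) ≤ 1 := by
        apply Real.exp_le_one_iff.mpr
        nlinarith [hs'.1]
      nlinarith [sq_nonneg B]
  have h0 : (0 : ℝ) ∈ Icc 0 T := ⟨le_rfl, ht.1.trans ht.2⟩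
  have := hanti h0 ht ht.1
  simp only [g, mul_zero, Real.exp_zero, one_mul, sub_zero] at this
  have h4 : Real.exp (K * t) * Real.exp (-K * t) = 1 := by
    rw [← Real.exp_add]; simp
  have h5 : Real.exp (K * t) * (Real.exp (-K * t) * ‖Z t‖ ^ 2)
      ≤ Real.exp (K * t) * (‖Z 0‖ ^ 2 + B ^ 2 * t) :=
    mul_le_mul_of_nonneg_left (by linarith) (Real.exp_pos _).le
  rwa [← mul_assoc, h4, one_mul] at h5

/-- A continuous one-sided Lipschitz field is approximated, uniformly on balls, by `C¹` fields with
the same one-sided Lipschitz constant. -/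
theorem exists_contDiff_approx {b : E d → E d} {L : ℝ} (hc : Continuous b)
    (hL : OneSidedLipschitz L b) (x₀ : E d) (R : ℝ) {ε : ℝ} (hε : 0 < ε) :
    ∃ c : E d → E d, ContDiff ℝ 1 c ∧ OneSidedLipschitz L c ∧
      ∀ x ∈ Metric.closedBall x₀ R, ‖c x - b x‖ ≤ ε := by
  have huc := (isCompact_closedBall x₀ (R + 1)).uniformContinuousOn_of_continuous hc.continuousOn
  obtain ⟨δ, hδ, hδ'⟩ := Metric.uniformContinuousOn_iff_le.mp huc ε hε
  have hm : 0 < min δ 1 := lt_min hδ one_pos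
  -- The cap `1` keeps the averaging inside the ball of radius `R + 1`, where uniform continuity is
  -- available.
  let φ : ContDiffBump (0 : E d) := ⟨min δ 1 / 2, min δ 1, by linarith, by linarith⟩
  let Λ := ContinuousLinearMap.lsmul ℝ ℝ (E := E d)
  refine ⟨convolution (φ.normed volume) b Λ volume, ?_, ?_, ?_⟩
  · exact_mod_cast φ.hasCompactSupport_normed.contDiff_convolution_left Λ (n := 1)
      φ.contDiff_normed hc.locallyIntegrable
  · intro x y
    have hex : ∀ x, Integrable (fun t => φ.normed volume t • b (x - t)) :=
      fun x => φ.hasCompactSupport_normed.convolutionExists_left Λ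
        φ.continuous_normed hc.locallyIntegrable x
    rw [convolution_def, convolution_def]
    simp only [Λ, ContinuousLinearMap.lsmul_apply]
    have hsub : Integrable
        (fun t => φ.normed volume t • b (x - t) - φ.normed volume t • b (y - t)) :=
      (hex x).sub (hex y)
    rw [← integral_sub (hex x) (hex y), real_inner_comm, ← integral_inner hsub]
    have hi : Integrable (fun t => φ.normed volume t * (L * ‖x - y‖ ^ 2)) :=
      φ.integrable_normed.mul_const _
    -- The condition is translation invariant and linear in the field, so averaging against a
    -- nonnegative kernel of mass one keeps `L`.
    calc _ ≤ ∫ t, φ.normed volume t * (L * ‖x - y‖ ^ 2) := by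
          apply integral_mono (hsub.const_inner _) hi
          intro t
          simp only
          rw [← smul_sub, inner_smul_right]
          apply mul_le_mul_of_nonneg_left _ (φ.nonneg_normed t)
          have := hL (x - t) (y - t)
          rwa [sub_sub_sub_cancel_right, real_inner_comm] at this
      _ = L * ‖x - y‖ ^ 2 := by rw [integral_mul_const, φ.integral_normed, one_mul]
  · intro x hx
    rw [← dist_eq_norm]
    apply φ.dist_normed_convolution_le hc.aestronglyMeasurable
    intro y hy
    have hy' : dist y x < min δ 1 := hy
    have hx' : dist x x₀ ≤ R := hx
    apply hδ' y _ x _ (hy'.le.trans (min_le_left _ _))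
    · have := dist_triangle y x x₀
      have := min_le_right δ 1
      simp only [Metric.mem_closedBall]; linarith
    · simp only [Metric.mem_closedBall]; linarith

/-! ### Solutions on compact intervals -/

/-- `X` solves `X' = b(X)` on `[0,T]` with `X 0 = x`. -/
def SolvesOn (b : E d → E d) (x : E d) (T : ℝ) (X : ℝ → E d) : Prop :=
  X 0 = x ∧ ∀ t ∈ Icc 0 T, HasDerivWithinAt X (b (X t)) (Icc 0 T) t

theorem SolvesOn.mono {b : E d → E d} {x : E d} {S T : ℝ} {X : ℝ → E d}
    (h : SolvesOn b x T X) (hST : S ≤ T) : SolvesOn b x S X :=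
  ⟨h.1, fun t ht => (h.2 t ⟨ht.1, ht.2.trans hST⟩).mono (Icc_subset_Icc_right hST)⟩

theorem SolvesOn.continuousOn {b : E d → E d} {x : E d} {T : ℝ} {X : ℝ → E d}
    (h : SolvesOn b x T X) : ContinuousOn X (Icc 0 T) :=
  fun t ht => (h.2 t ht).continuousWithinAt

/-- Stability of solutions: two vector fields that are `B`-close along the second solution. -/
theorem SolvesOn.norm_sub_sq_le {b c : E d → E d} {x y : E d} {T L B : ℝ} {X Y : ℝ → E d}
    (hL0 : 0 ≤ L) (hL : OneSidedLipschitz L b) (hX : SolvesOn b x T X) (hY : SolvesOn c y T Y)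
    (hB : ∀ t ∈ Icc 0 T, ‖b (Y t) - c (Y t)‖ ≤ B) {t : ℝ} (ht : t ∈ Icc 0 T) :
    ‖X t - Y t‖ ^ 2 ≤ Real.exp ((2 * L + 1) * t) * (‖x - y‖ ^ 2 + B ^ 2 * t) := by
  have := norm_sq_le_of_inner_deriv_le hL0 (Z := fun t => X t - Y t)
    (Z' := fun t => b (X t) - c (Y t)) (L := L) (B := B)
    (fun s hs => (hX.2 s hs).sub (hY.2 s hs)) ?_ ht
  · simpa only [hX.1, hY.1] using this
  · intro s hs
    have h1 := hL (X s) (Y s)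
    have h2 := real_inner_le_norm (b (Y s) - c (Y s)) (X s - Y s)
    have h3 := mul_le_mul_of_nonneg_right (hB s hs) (norm_nonneg (X s - Y s))
    have h4 : b (X s) - c (Y s) = (b (X s) - b (Y s)) + (b (Y s) - c (Y s)) := by abel
    rw [h4, inner_add_left]
    linarith

/-- Only a bound relative to the point `x` is assumed, because this form survives a cutoff of the
field. -/
theorem SolvesOn.norm_sub_start_sq_le {c : E d → E d} {x : E d} {T L B : ℝ} {X : ℝ → E d}
    (hL : 0 ≤ L) (hX : SolvesOn c x T X)
    (hc : ∀ y, inner ℝ (c y) (y - x) ≤ L * ‖y - x‖ ^ 2 + B * ‖y - x‖) {t : ℝ}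
    (ht : t ∈ Icc 0 T) :
    ‖X t - x‖ ^ 2 ≤ Real.exp ((2 * L + 1) * t) * (B ^ 2 * t) := by
  have := norm_sq_le_of_inner_deriv_le hL (Z := fun t => X t - x) (Z' := fun t => c (X t)) (L := L)
    (B := B) (fun s hs => (hX.2 s hs).sub_const x) (fun s _ => hc (X s)) ht
  simpa [hX.1] using this

theorem OneSidedLipschitz.inner_le {L B : ℝ} {c : E d → E d} (hL : OneSidedLipschitz L c)
    {x : E d} (hB : ‖c x‖ ≤ B) (y : E d) :
    inner ℝ (c y) (y - x) ≤ L * ‖y - x‖ ^ 2 + B * ‖y - x‖ := by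
  have h1 := hL y x
  have h2 := real_inner_le_norm (c x) (y - x)
  have h3 := mul_le_mul_of_nonneg_right hB (norm_nonneg (y - x))
  rw [inner_sub_left] at h1
  linarith

/-- Solutions of `C¹` one-sided Lipschitz systems exist on every compact interval. -/
theorem exists_solvesOn_of_contDiff {c : E d → E d} {L B R : ℝ} (hc : ContDiff ℝ 1 c)
    (hL0 : 0 ≤ L) (hL : OneSidedLipschitz L c) (x : E d) {T : ℝ} (hT : 0 ≤ T)
    (hB : ‖c x‖ ≤ B) (hR0 : 0 < R) (hR : Real.exp ((2 * L + 1) * T) * (B ^ 2 * T) ≤ R ^ 2) :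
    ∃ X : ℝ → E d, SolvesOn c x T X ∧ ∀ t ∈ Icc 0 T, X t ∈ Metric.closedBall x R := by
  -- The cut-off field is globally Lipschitz and bounded, so Picard–Lindelöf reaches time `T` at
  -- once; the a priori bound then keeps the solution where `χ = 1`.
  let χ : ContDiffBump x := ⟨R, R + 1, hR0, by linarith⟩
  have hχc : HasCompactSupport (fun y => χ y • c y) := χ.hasCompactSupport.smul_right
  have hχd : ContDiff ℝ 1 (fun y => χ y • c y) := (χ.contDiff (n := 1)).smul hc
  obtain ⟨K, hK⟩ := hχd.lipschitzWith_of_hasCompactSupport hχc one_ne_zero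
  obtain ⟨M, hM⟩ := hχc.exists_bound_of_continuous hχd.continuous
  have hM0 : 0 ≤ M := (norm_nonneg _).trans (hM x)
  have hPL : IsPicardLindelof (fun _ : ℝ => fun y => χ y • c y) (tmin := 0) (tmax := T)
      ⟨0, le_rfl, hT⟩ x (M.toNNReal * T.toNNReal) 0 M.toNNReal K :=
    { lipschitzOnWith := fun _ _ => hK.lipschitzOnWith
      continuousOn := fun _ _ => continuousOn_const
      norm_le := fun _ _ y _ => by rw [Real.coe_toNNReal _ hM0]; exact hM y
      mul_max_le := by simp [hT] }
  obtain ⟨X, hX0, hX⟩ := hPL.exists_eq_forall_mem_Icc_hasDerivWithinAt₀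
  have hS : SolvesOn (fun y => χ y • c y) x T X := ⟨hX0, hX⟩
  have hball : ∀ t ∈ Icc 0 T, X t ∈ Metric.closedBall x R := by
    intro t ht
    have h1 := hS.norm_sub_start_sq_le hL0 (L := L) (B := B) (fun y => ?_) ht
    · rw [mem_closedBall_iff_norm]
      apply le_of_sq_le_sq _ hR0.le
      refine h1.trans (le_trans ?_ hR)
      have hB2 : 0 ≤ B ^ 2 := sq_nonneg B
      have ht0 := ht.1
      have ht1 := ht.2
      gcongr
    -- Multiplying by `χ ∈ [0, 1]` is harmless since the right-hand side is nonnegative.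
    · rw [inner_smul_left]
      have h2 := hL.inner_le hB y
      have h3 : 0 ≤ L * ‖y - x‖ ^ 2 + B * ‖y - x‖ := by
        have := (norm_nonneg (c x)).trans hB
        positivity
      have h4 := χ.nonneg (x := y)
      have h5 := χ.le_one (x := y)
      simp only [conj_trivial]
      nlinarith
  refine ⟨X, ⟨hX0, fun t ht => ?_⟩, hball⟩
  have h := hX t ht
  rwa [χ.one_of_mem_closedBall (hball t ht), one_smul] at h

/-- Solutions of continuous one-sided Lipschitz systems exist on every compact interval. -/
theorem exists_solvesOn {b : E d → E d} {L : ℝ} (hc : Continuous b) (hL0 : 0 ≤ L)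
    (hL : OneSidedLipschitz L b) (x : E d) {T : ℝ} (hT : 0 ≤ T) :
    ∃ X : ℝ → E d, SolvesOn b x T X := by
  set A := Real.exp ((2 * L + 1) * T) with hA
  -- `‖b x‖ + 1` will bound all approximating fields at `x`, so one radius serves for every `n`.
  obtain ⟨R, hR0, hR⟩ : ∃ R : ℝ, 0 < R ∧ A * ((‖b x‖ + 1) ^ 2 * T) ≤ R ^ 2 := by
    refine ⟨A * ((‖b x‖ + 1) ^ 2 * T) + 1, by positivity, ?_⟩
    have : 0 ≤ A * ((‖b x‖ + 1) ^ 2 * T) := by positivity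
    nlinarith
  set e : ℕ → ℝ := fun n => 1 / ((n : ℝ) + 1) with he
  have he0 : ∀ n, 0 < e n := fun n => Nat.one_div_pos_of_nat
  have he1 : ∀ n, e n ≤ 1 := fun n => by
    simp only [he]; rw [div_le_one (by positivity)]; linarith [n.cast_nonneg (α := ℝ)]
  have hanti : Antitone e := fun m n h => Nat.one_div_le_one_div h
  choose c hcd hcL hcb using fun n => exists_contDiff_approx hc hL x R (he0 n)
  have hcx : ∀ n, ‖c n x‖ ≤ ‖b x‖ + 1 := fun n => by
    have h1 := hcb n x (Metric.mem_closedBall_self hR0.le)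
    have h2 := norm_le_insert' (c n x) (b x)
    linarith [he1 n]
  choose X hX hXb using fun n => exists_solvesOn_of_contDiff (hcd n) hL0 (hcL n) x hT (hcx n) hR0 hR
  -- Along `X m` the fields `c n` and `c m` differ by at most `2 * e N`; stability with the common
  -- `L` gives a uniform Cauchy bound.
  have hest : ∀ N n m, N ≤ n → N ≤ m → ∀ t ∈ Icc 0 T,
      dist (X n t) (X m t) ≤ √(A * T) * (2 * e N) := by
    intro N n m hn hm t ht
    have h1 := (hX n).norm_sub_sq_le hL0 (hcL n) (hX m) (B := 2 * e N) (fun s hs => ?_) ht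
    · rw [dist_eq_norm]
      apply le_of_sq_le_sq _ (by have := he0 N; positivity)
      rw [mul_pow, Real.sq_sqrt (by positivity)]
      refine h1.trans ?_
      have ht0 := ht.1
      have ht1 := ht.2
      have : Real.exp ((2 * L + 1) * t) ≤ A := by rw [hA]; gcongr
      rw [sub_self, norm_zero, zero_pow two_ne_zero, zero_add]
      calc _ ≤ A * ((2 * e N) ^ 2 * T) := by gcongr
        _ = A * T * (2 * e N) ^ 2 := by ring
    · have h2 := hcb n (X m s) (hXb m s hs)
      have h3 := hcb m (X m s) (hXb m s hs)
      have h4 := norm_sub_le_norm_sub_add_norm_sub (c n (X m s)) (b (X m s)) (c m (X m s))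
      rw [norm_sub_rev (b _)] at h4
      linarith [hanti hn, hanti hm]
  have hbd : Tendsto (fun N => √(A * T) * (2 * e N)) atTop (𝓝 0) := by
    have h : Tendsto e atTop (𝓝 0) := tendsto_one_div_add_atTop_nhds_zero_nat
    simpa using (h.const_mul 2).const_mul (√(A * T))
  have hlim : ∀ t, ∃ y, t ∈ Icc 0 T → Tendsto (fun n => X n t) atTop (𝓝 y) := by
    intro t
    by_cases ht : t ∈ Icc 0 T
    · obtain ⟨y, hy⟩ := cauchySeq_tendsto_of_complete
        (cauchySeq_of_le_tendsto_0 _ (fun n m N hn hm => hest N n m hn hm t ht) hbd)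
      exact ⟨y, fun _ => hy⟩
    · exact ⟨0, fun h => absurd h ht⟩
  choose Y hY using hlim
  have hunif : TendstoUniformlyOn X Y atTop (Icc 0 T) := by
    refine UniformCauchySeqOn.tendstoUniformlyOn_of_tendsto ?_ hY
    rw [Metric.uniformCauchySeqOn_iff]
    intro ε hε
    obtain ⟨N, hN⟩ := (hbd.eventually (gt_mem_nhds hε)).exists
    exact ⟨N, fun m hm n hn t ht => (hest N m n hm hn t ht).trans_lt hN⟩
  have hYc : ContinuousOn Y (Icc 0 T) :=
    hunif.continuousOn (Frequently.of_forall fun n => (hX n).continuousOn)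
  have hYb : ∀ t ∈ Icc 0 T, Y t ∈ Metric.closedBall x R := fun t ht =>
    Metric.isClosed_closedBall.mem_of_tendsto (hY t ht) (Eventually.of_forall fun n => hXb n t ht)
  have hcY : ∀ t ∈ Icc 0 T, Tendsto (fun n => c n (X n t)) atTop (𝓝 (b (Y t))) := by
    intro t ht
    have h1 : Tendsto (fun n => b (X n t)) atTop (𝓝 (b (Y t))) :=
      (hc.tendsto _).comp (hY t ht)
    have h2 : Tendsto (fun n => c n (X n t) - b (X n t)) atTop (𝓝 0) :=
      squeeze_zero_norm (fun n => hcb n _ (hXb n t ht))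
        (tendsto_one_div_add_atTop_nhds_zero_nat (𝕜 := ℝ))
    simpa using h2.add h1
  obtain ⟨M, hM⟩ := (isCompact_closedBall x R).exists_bound_of_continuousOn hc.continuousOn
  -- The limit is taken in the integral equation, by dominated convergence.
  have hint : ∀ t ∈ Icc 0 T, Y t = x + ∫ s in (0 : ℝ)..t, b (Y s) := by
    intro t ht
    have hsub : Icc 0 t ⊆ Icc 0 T := Icc_subset_Icc_right ht.2
    have hcont : ∀ n, ContinuousOn (fun s => c n (X n s)) (Icc 0 t) := fun n =>
      (hcd n).continuous.comp_continuousOn ((hX n).continuousOn.mono hsub)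
    have hFTC : ∀ n, ∫ s in (0 : ℝ)..t, c n (X n s) = X n t - x := by
      intro n
      rw [← (hX n).1]
      refine intervalIntegral.integral_eq_sub_of_hasDeriv_right_of_le ht.1
        ((hX n).continuousOn.mono hsub) (fun s hs => ?_) ?_
      · have h := (hX n).2 s ⟨hs.1.le, hs.2.le.trans ht.2⟩
        exact (h.hasDerivAt (Icc_mem_nhds hs.1 (hs.2.trans_le ht.2))).hasDerivWithinAt
      · exact (hcont n).intervalIntegrable_of_Icc ht.1
    have h1 : Tendsto (fun n => ∫ s in (0 : ℝ)..t, c n (X n s)) atTop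
        (𝓝 (∫ s in (0 : ℝ)..t, b (Y s))) := by
      have hmem : ∀ s, s ∈ uIoc 0 t → s ∈ Icc 0 T := fun s hs => by
        rw [uIoc_of_le ht.1] at hs
        exact ⟨hs.1.le, hs.2.trans ht.2⟩
      refine intervalIntegral.tendsto_integral_filter_of_dominated_convergence (fun _ => M + 1)
        (Eventually.of_forall fun n => ?_) (Eventually.of_forall fun n => ae_of_all _ fun s hs => ?_)
        intervalIntegrable_const (ae_of_all _ fun s hs => hcY s (hmem s hs))
      · rw [uIoc_of_le ht.1]
        exact ((hcont n).mono Ioc_subset_Icc_self).aestronglyMeasurable measurableSet_Ioc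
      · have h2 := hXb n s (hmem s hs)
        have h3 := norm_le_insert' (c n (X n s)) (b (X n s))
        linarith [hcb n _ h2, hM _ h2, he1 n]
    have h2 := tendsto_nhds_unique h1 (by simpa only [hFTC] using (hY t ht).sub_const x)
    rw [h2]; abel
  refine ⟨Y, ?_, fun t ht => ?_⟩
  · simpa using hint 0 ⟨le_rfl, hT⟩
  · have hbY : ContinuousOn (fun s => b (Y s)) (Icc 0 T) := hc.comp_continuousOn hYc
    have h1 : HasDerivWithinAt (fun u => ∫ s in (0 : ℝ)..u, b (Y s)) (b (Y t)) (Icc 0 T) t := by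
      have : Fact (t ∈ Icc 0 T) := ⟨ht⟩
      refine intervalIntegral.integral_hasDerivWithinAt_right
        ((hbY.mono (Icc_subset_Icc_right ht.2)).intervalIntegrable_of_Icc ht.1)
        (hbY.stronglyMeasurableAtFilter_nhdsWithin measurableSet_Icc t) (hbY t ht)
    exact (h1.const_add x).congr hint (hint t ht)

/-- Two solutions with the same starting point agree. -/
theorem SolvesOn.eq {b : E d → E d} {x : E d} {T L : ℝ} {X Y : ℝ → E d} (hL0 : 0 ≤ L)
    (hL : OneSidedLipschitz L b) (hX : SolvesOn b x T X) (hY : SolvesOn b x T Y) {t : ℝ}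
    (ht : t ∈ Icc 0 T) : X t = Y t := by
  have := hX.norm_sub_sq_le hL0 hL hY (B := 0) (fun _ _ => by simp) ht
  simp only [sub_self, norm_zero, ne_eq, OfNat.ofNat_ne_zero, not_false_eq_true, zero_pow,
    zero_mul, add_zero, mul_zero] at this
  exact sub_eq_zero.mp (norm_eq_zero.mp (pow_eq_zero_iff two_ne_zero |>.mp
    (le_antisymm this (sq_nonneg _))))

/-! ### The global semiflow -/

/-- Continuous one-sided Lipschitz vector fields generate a global semiflow. -/
theorem exists_isFlow {b : E d → E d} {L : ℝ} (hc : Continuous b) (hL0 : 0 ≤ L)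
    (hL : OneSidedLipschitz L b) : ∃ X : ℝ → E d → E d, IsFlow b X := by
  choose X hX using fun (x : E d) (n : ℕ) => exists_solvesOn hc hL0 hL x n.cast_nonneg
  have heq : ∀ x (n : ℕ) (t : ℝ), t ∈ Icc 0 (n : ℝ) → X x (⌊t⌋₊ + 1) t = X x n t := by
    intro x n t ht
    rcases le_total (⌊t⌋₊ + 1) n with h | h
    · exact (hX x _).eq hL0 hL ((hX x n).mono (by exact_mod_cast h))
        ⟨ht.1, by exact_mod_cast (Nat.lt_floor_add_one t).le⟩
    · exact ((hX x _).mono (by exact_mod_cast h)).eq hL0 hL (hX x n) ht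
  refine ⟨fun t x => X x (⌊t⌋₊ + 1) t, fun x => ⟨(hX x _).1, fun t ht => ?_⟩⟩
  -- Since `t < n` strictly, the single solution `X x n` describes the glued curve on a
  -- neighbourhood of `t` in `[0, ∞)`.
  set n := ⌊t⌋₊ + 1 with hn
  have htn : t < (n : ℝ) := by rw [hn]; exact_mod_cast Nat.lt_floor_add_one t
  have h1 : HasDerivWithinAt (X x n) (b (X x n t)) (Ici 0) t :=
    ((hX x n).2 t ⟨ht, htn.le⟩).mono_of_mem_nhdsWithin
      (by
        rw [← Ici_inter_Iic]
        exact inter_mem self_mem_nhdsWithin (mem_nhdsWithin_of_mem_nhds (Iic_mem_nhds htn)))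
  refine h1.congr_of_eventuallyEq ?_ rfl
  filter_upwards [self_mem_nhdsWithin, mem_nhdsWithin_of_mem_nhds (Iic_mem_nhds htn)] with s hs hs'
  exact heq x n s ⟨hs, hs'⟩

theorem IsFlow.solvesOn {b : E d → E d} {X : ℝ → E d → E d} (hX : IsFlow b X) (x : E d) (T : ℝ) :
    SolvesOn b x T (fun t => X t x) :=
  ⟨(hX x).1, fun t ht => ((hX x).2 t ht.1).mono Icc_subset_Ici_self⟩

/-! ### The transport operator and sign symmetry -/

theorem transportOp_eq_fderiv (b : E d → E d) {φ : ℝ × E d → ℝ} (hφ : ContDiff ℝ 1 φ) (t : ℝ)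
    (x : E d) : transportOp b φ t x = fderiv ℝ φ (t, x) (1, -b x) := by
  have hd : HasFDerivAt φ (fderiv ℝ φ (t, x)) (t, x) :=
    (hφ.differentiable one_ne_zero _).hasFDerivAt
  have h1 : HasDerivAt (fun s : ℝ => φ (s, x)) (fderiv ℝ φ (t, x) (1, 0)) t :=
    hd.comp_hasDerivAt t ((hasDerivAt_id t).prodMk (hasDerivAt_const t x))
  have h2 : HasFDerivAt (fun y : E d => φ (t, y))
      ((fderiv ℝ φ (t, x)).comp (ContinuousLinearMap.inr ℝ ℝ (E d))) x :=
    HasFDerivAt.comp x hd (hasFDerivAt_prodMk_right t x)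
  rw [transportOp, h1.deriv, real_inner_comm, inner_gradient_left, h2.fderiv,
    ContinuousLinearMap.comp_apply, ContinuousLinearMap.inr_apply, ← map_sub]
  simp

theorem transportOp_eq_of_hasDerivAt {b : E d → E d} {φ : ℝ × E d → ℝ} (hφ : ContDiff ℝ 1 φ)
    {t D : ℝ} {x : E d} (hD : HasDerivAt (fun s : ℝ => φ (t + s, x - s • b x)) D 0) :
    transportOp b φ t x = D := by
  rw [transportOp_eq_fderiv b hφ]
  have hc : HasDerivAt (fun s : ℝ => (t + s, x - s • b x)) ((1 : ℝ), -b x) 0 := by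
    have h1 : HasDerivAt (fun s : ℝ => t + s) 1 0 := (hasDerivAt_id (0 : ℝ)).const_add t
    have h2 : HasDerivAt (fun s : ℝ => x - s • b x) (-b x) 0 := by
      simpa using ((hasDerivAt_id (0 : ℝ)).smul_const (b x)).const_sub x
    exact h1.prodMk h2
  have hd : HasFDerivAt φ (fderiv ℝ φ (t, x)) (t + 0, x - (0 : ℝ) • b x) := by
    simpa using (hφ.differentiable one_ne_zero (t, x)).hasFDerivAt
  exact (hd.comp_hasDerivAt (0 : ℝ) hc).unique hD

theorem transportOp_neg (b : E d → E d) {φ : ℝ × E d → ℝ} (hφ : ContDiff ℝ 1 φ) (t : ℝ)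
    (x : E d) : transportOp b (fun p => -φ p) t x = -transportOp b φ t x := by
  rw [transportOp_eq_fderiv b hφ.neg, transportOp_eq_fderiv b hφ, fderiv_fun_neg]
  rfl

theorem bddBelow_range_neg {α : Type*} {u : α → ℝ} (h : BddAbove (range u)) :
    BddBelow (range fun p => -u p) := by
  obtain ⟨M, hM⟩ := h
  exact ⟨-M, by rintro _ ⟨p, rfl⟩; exact neg_le_neg (hM ⟨p, rfl⟩)⟩

theorem bddAbove_range_neg {α : Type*} {u : α → ℝ} (h : BddBelow (range u)) :
    BddAbove (range fun p => -u p) := by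
  obtain ⟨M, hM⟩ := h
  exact ⟨-M, by rintro _ ⟨p, rfl⟩; exact neg_le_neg (hM ⟨p, rfl⟩)⟩

/-- The equation is linear, so a sign change swaps the two notions and later arguments need only
subsolutions. -/
theorem IsViscositySubsolution.neg {b : E d → E d} {f : E d → ℝ} {u : ℝ≥0 × E d → ℝ}
    (h : IsViscositySubsolution b f u) :
    IsViscositySupersolution b (fun x => -f x) (fun p => -u p) where
  lsc := fun p y hy => by
    filter_upwards [h.usc p (-y) (by linarith)] with q hq
    linarith
  bddBelow := bddBelow_range_neg h.bddAbove
  test := fun φ hφ t x ht hmax => by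
    have := h.test (fun p => -φ p) hφ.neg t x ht (fun p hp => ?_)
    · rw [transportOp_neg b hφ] at this
      linarith
    · have := hmax hp
      simp only [mem_ofPred_eq] at this ⊢
      linarith
  initial := fun x => neg_le_neg (h.initial x)

theorem IsViscositySupersolution.neg {b : E d → E d} {f : E d → ℝ} {u : ℝ≥0 × E d → ℝ}
    (h : IsViscositySupersolution b f u) :
    IsViscositySubsolution b (fun x => -f x) (fun p => -u p) where
  usc := fun p y hy => by
    filter_upwards [h.lsc p (-y) (by linarith)] with q hq
    linarith
  bddAbove := bddAbove_range_neg h.bddBelow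
  test := fun φ hφ t x ht hmin => by
    have := h.test (fun p => -φ p) hφ.neg t x ht (fun p hp => ?_)
    · rw [transportOp_neg b hφ] at this
      linarith
    · have := hmin hp
      simp only [mem_ofPred_eq] at this ⊢
      linarith
  initial := fun x => neg_le_neg (h.initial x)

/-! ### The transported datum is a solution -/

/-- Gronwall gives a Lipschitz bound in `x`, locally uniform in `t`; each orbit is continuous in
`t`. -/
theorem IsFlow.continuous {b : E d → E d} {L : ℝ} (hL0 : 0 ≤ L) (hL : OneSidedLipschitz L b)
    {X : ℝ → E d → E d} (hX : IsFlow b X) :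
    Continuous (fun p : ℝ≥0 × E d => X p.1 p.2) := by
  rw [continuous_iff_continuousAt]
  rintro ⟨t₀, x₀⟩
  have hXt : Continuous (fun t : ℝ≥0 => X t x₀) := by
    have : ContinuousOn (fun t : ℝ => X t x₀) (Ici 0) :=
      fun t ht => ((hX x₀).2 t ht).continuousWithinAt
    exact this.comp_continuous NNReal.continuous_coe (fun t => t.2)
  have hbound : ∀ p : ℝ≥0 × E d, dist (X p.1 p.2) (X t₀ x₀) ≤
      √(Real.exp ((2 * L + 1) * p.1)) * ‖p.2 - x₀‖ + dist (X p.1 x₀) (X t₀ x₀) := by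
    rintro ⟨t, x⟩
    refine (dist_triangle _ (X t x₀) _).trans (add_le_add_left ?_ _)
    have h := (hX.solvesOn x t).norm_sub_sq_le hL0 hL (hX.solvesOn x₀ t) (B := 0)
      (fun _ _ => by simp) ⟨t.2, le_rfl⟩
    rw [dist_eq_norm]
    apply le_of_sq_le_sq _ (by positivity)
    rw [mul_pow, Real.sq_sqrt (Real.exp_pos _).le]
    simpa using h
  rw [ContinuousAt, tendsto_iff_dist_tendsto_zero]
  refine squeeze_zero (fun _ => dist_nonneg) hbound ?_
  have hcont : Continuous (fun p : ℝ≥0 × E d =>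
      √(Real.exp ((2 * L + 1) * p.1)) * ‖p.2 - x₀‖ + dist (X p.1 x₀) (X t₀ x₀)) := by
    have := hXt.comp (continuous_fst (X := ℝ≥0) (Y := E d))
    have h2 : Continuous (fun p : ℝ≥0 × E d => dist (X p.1 x₀) (X t₀ x₀)) :=
      this.dist continuous_const
    fun_prop
  simpa using hcont.tendsto (t₀, x₀)

theorem IsFlow.semigroup {b : E d → E d} {L : ℝ} (hL0 : 0 ≤ L) (hL : OneSidedLipschitz L b)
    {X : ℝ → E d → E d} (hX : IsFlow b X) (x : E d) {h s : ℝ} (hh : 0 ≤ h) (hs : 0 ≤ s) :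
    X s (X h x) = X (h + s) x := by
  have hshift : SolvesOn b (X h x) s (fun r => X (h + r) x) := by
    refine ⟨by simp, fun r hr => ?_⟩
    have h1 : HasDerivWithinAt (fun r : ℝ => h + r) 1 (Icc 0 s) r :=
      ((hasDerivAt_id r).const_add h).hasDerivWithinAt
    have h2 := ((hX x).2 (h + r) (add_nonneg hh hr.1)).scomp r h1
      (fun q hq => add_nonneg hh hq.1)
    rw [one_smul] at h2
    exact h2
  exact (hX.solvesOn (X h x) s).eq hL0 hL hshift ⟨hs, le_rfl⟩

/-- Transporting the initial datum along the flow gives a viscosity subsolution. -/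
theorem IsFlow.isViscositySubsolution {b : E d → E d} {f : E d → ℝ} {L : ℝ} (hL0 : 0 ≤ L)
    (hL : OneSidedLipschitz L b) {X : ℝ → E d → E d} (hX : IsFlow b X) (hf : Continuous f)
    {M : ℝ} (hM : ∀ x, |f x| ≤ M) :
    IsViscositySubsolution b f (fun p => f (X p.1 p.2)) where
  usc := (hf.comp (hX.continuous hL0 hL)).upperSemicontinuous
  bddAbove := ⟨M, by rintro _ ⟨p, rfl⟩; exact (abs_le.mp (hM _)).2⟩
  initial := fun x => by simp [(hX x).1]
  test := fun φ hφ t x ht hmin => by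
    have ht' : (0 : ℝ) < t := ht
    have hd : HasFDerivAt φ (fderiv ℝ φ (t, x)) ((t : ℝ) - 0, X 0 x) := by
      rw [(hX x).1, sub_zero]
      exact (hφ.differentiable one_ne_zero (t, x)).hasFDerivAt
    -- Going back in time while following the flow needs only forward trajectories; a one-sided
    -- slope at `h = 0` suffices.
    have hc : HasDerivWithinAt (fun h : ℝ => ((t : ℝ) - h, X h x)) ((-1 : ℝ), b x) (Ici 0) 0 := by
      have h1 : HasDerivAt (fun h : ℝ => (t : ℝ) - h) (-1) 0 :=
        (hasDerivAt_id (0 : ℝ)).const_sub _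
      have h2 := (hX x).2 0 le_rfl
      rw [(hX x).1] at h2
      exact h1.hasDerivWithinAt.prodMk h2
    have hG := hd.comp_hasDerivWithinAt (0 : ℝ) hc
    have hval : fderiv ℝ φ (t, x) ((-1 : ℝ), b x) = -transportOp b φ t x := by
      rw [transportOp_eq_fderiv b hφ, ← map_neg]
      simp
    rw [hval] at hG
    replace hG := (hasDerivWithinAt_iff_tendsto_slope' self_notMem_Ioi).mp
      (hG.mono Ioi_subset_Ici_self)
    have : 0 ≤ -transportOp b φ t x := by
      refine ge_of_tendsto hG ?_
      filter_upwards [Ioo_mem_nhdsGT ht'] with h hh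
      have hth : (0 : ℝ) ≤ t - h := by linarith [hh.2]
      have hmem : ((⟨t - h, hth⟩ : ℝ≥0), X h x) ∈ openDomain d := by
        change (0 : ℝ) < t - h
        linarith [hh.2]
      have h3 : φ (t, x) - f (X t x) ≤ φ ((t : ℝ) - h, X h x) - f (X ((t : ℝ) - h) (X h x)) :=
        hmin hmem
      have h4 := hX.semigroup hL0 hL x hh.1.le hth
      rw [add_sub_cancel] at h4
      rw [h4] at h3
      rw [slope_def_field]
      apply div_nonneg _ (by linarith [hh.1])
      simp only [Function.comp_apply, sub_zero, (hX x).1]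
      linarith
    linarith

theorem IsFlow.isViscositySolution {b : E d → E d} {f : E d → ℝ} {L : ℝ} (hL0 : 0 ≤ L)
    (hL : OneSidedLipschitz L b) {X : ℝ → E d → E d} (hX : IsFlow b X) (hf : Continuous f)
    {M : ℝ} (hM : ∀ x, |f x| ≤ M) :
    IsViscositySolution b f (fun p => f (X p.1 p.2)) where
  continuous := hf.comp (hX.continuous hL0 hL)
  bounded := ⟨M, fun _ => hM _⟩
  sub := hX.isViscositySubsolution hL0 hL hf hM
  super := by
    simpa using (hX.isViscositySubsolution hL0 hL hf.neg (M := M) (by simpa using hM)).neg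

/-! ### Comparison along characteristics -/

/-- A continuous subsolution does not exceed its initial datum transported along a backward
characteristic. -/
theorem IsViscositySubsolution.le_of_characteristic {b : E d → E d} {f : E d → ℝ} {L M : ℝ}
    (hL : OneSidedLipschitz L b) (hf : Continuous f) (hM : ∀ x, f x ≤ M)
    {u : ℝ≥0 × E d → ℝ} (hu : IsViscositySubsolution b f u) (huc : Continuous u)
    {Y : ℝ → E d} {T : ℝ} (hYd : ContDiff ℝ 1 Y)
    (hY : ∀ t ∈ Ioo 0 T, HasDerivAt Y (-b (Y t)) t) {S : ℝ≥0} (hS0 : 0 < S) (hST : S < T) :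
    u (S, Y S) ≤ f (Y 0) := by
  have hS0' : (0 : ℝ) < S := hS0
  obtain ⟨Mu, hMu⟩ := hu.bddAbove
  replace hMu : ∀ p, u p ≤ Mu := fun p => hMu ⟨p, rfl⟩
  refine le_of_forall_pos_le_add fun η hη => ?_
  obtain ⟨δ, hδ, rfl⟩ : ∃ δ : ℝ, 0 < δ ∧ η = δ + δ := ⟨η / 2, by linarith, by ring⟩
  -- penalization constant forcing the initial value near `f (Y 0)`
  obtain ⟨K, hK, hKf⟩ : ∃ K : ℝ, 0 < K ∧ ∀ y, f y - K * ‖y - Y 0‖ ^ 2 ≤ f (Y 0) + δ := by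
    obtain ⟨r, hr, hr'⟩ := Metric.continuous_iff.mp hf (Y 0) δ hδ
    refine ⟨(M - f (Y 0) + 1) / r ^ 2, ?_, fun y => ?_⟩
    · have := hM (Y 0)
      have : 0 < M - f (Y 0) + 1 := by linarith
      positivity
    · have hpos : 0 < M - f (Y 0) + 1 := by linarith [hM (Y 0)]
      by_cases hy : dist y (Y 0) < r
      · have h1 := (abs_lt.mp (hr' y hy)).2
        have : 0 ≤ (M - f (Y 0) + 1) / r ^ 2 * ‖y - Y 0‖ ^ 2 := by positivity
        linarith
      · rw [dist_eq_norm, not_lt] at hy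
        have h1 : (M - f (Y 0) + 1) / r ^ 2 * r ^ 2 ≤ (M - f (Y 0) + 1) / r ^ 2 * ‖y - Y 0‖ ^ 2 := by
          gcongr
        rw [div_mul_cancel₀ _ (by positivity)] at h1
        linarith [hM y]
  -- Chosen so that `Mu - D` is the penalized value at `(S, Y S)`; `n` then makes the time barrier
  -- exceed `D` from time `T` on.
  set D := Mu - u (S, Y S) + δ with hDdef
  have hD : 0 < D := by linarith [hMu (S, Y S)]
  obtain ⟨n, hn, hnD⟩ : ∃ n : ℝ, 0 < n ∧ D < δ * Real.exp (n * (T - S)) := by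
    have hTS : 0 < T - S := by linarith
    refine ⟨D / δ / (T - S), by positivity, ?_⟩
    rw [div_mul_cancel₀ _ hTS.ne']
    have h1 := Real.add_one_le_exp (D / δ)
    have h2 : δ * (D / δ + 1) ≤ δ * Real.exp (D / δ) := by gcongr
    rw [mul_add, mul_div_cancel₀ _ hδ.ne'] at h2
    linarith
  -- The exponential weight makes the operator nonnegative on the quadratic term; the time barrier
  -- makes it strictly positive, which excludes interior maxima of `u - φ` before `T`.
  let φ : ℝ × E d → ℝ := fun p =>
    K * Real.exp (2 * |L| * p.1) * ‖p.2 - Y p.1‖ ^ 2 + δ * Real.exp (n * (p.1 - S))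
  have hφ : ContDiff ℝ 1 φ := by
    have h1 : ContDiff ℝ 1 (fun p : ℝ × E d => ‖p.2 - Y p.1‖ ^ 2) :=
      (contDiff_snd.sub (hYd.comp contDiff_fst)).norm_sq ℝ
    have h2 : ContDiff ℝ 1 (fun p : ℝ × E d => Real.exp (2 * |L| * p.1)) :=
      (contDiff_const.mul contDiff_fst).exp
    have h3 : ContDiff ℝ 1 (fun p : ℝ × E d => Real.exp (n * (p.1 - S))) :=
      (contDiff_const.mul (contDiff_fst.sub contDiff_const)).exp
    exact ((contDiff_const.mul h2).mul h1).add (contDiff_const.mul h3)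
  have hop : ∀ t ∈ Ioo 0 T, ∀ x, 0 < transportOp b φ t x := by
    intro t ht x
    have hin : HasDerivAt (fun s : ℝ => t + s) 1 0 := (hasDerivAt_id (0 : ℝ)).const_add t
    have hYt : HasDerivAt (fun s : ℝ => Y (t + s)) (-b (Y t)) 0 := by
      have h0 : HasDerivAt Y (-b (Y t)) (t + 0) := by rw [add_zero]; exact hY t ht
      have h := h0.scomp (0 : ℝ) hin
      rw [one_smul] at h
      exact h
    have hxs : HasDerivAt (fun s : ℝ => x - s • b x) (-b x) 0 := by
      simpa using ((hasDerivAt_id (0 : ℝ)).smul_const (b x)).const_sub x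
    have h1 := (hxs.sub hYt).norm_sq
    have h2 := ((hin.const_mul (2 * |L|)).exp.const_mul K).mul h1
    have h3 := ((hin.sub_const (S : ℝ)).const_mul n).exp.const_mul δ
    rw [transportOp_eq_of_hasDerivAt hφ (h2.add h3)]
    simp only [zero_smul, sub_zero, add_zero, mul_one, Pi.sub_apply]
    have h4 := hL x (Y t)
    have h5 : inner ℝ (x - Y t) (-b x - -b (Y t)) = -inner ℝ (b x - b (Y t)) (x - Y t) := by
      rw [real_inner_comm, ← inner_neg_left]
      congr 1
      abel
    rw [h5]
    have h6 : L * ‖x - Y t‖ ^ 2 ≤ |L| * ‖x - Y t‖ ^ 2 := by gcongr; exact le_abs_self L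
    have h7 : 0 ≤ K * Real.exp (2 * |L| * t) *
        (2 * (|L| * ‖x - Y t‖ ^ 2 - inner ℝ (b x - b (Y t)) (x - Y t))) := by
      have : 0 ≤ |L| * ‖x - Y t‖ ^ 2 - inner ℝ (b x - b (Y t)) (x - Y t) := by linarith
      positivity
    have h8 : 0 < δ * (Real.exp (n * (t - S)) * n) := by positivity
    linarith
  let w : ℝ≥0 × E d → ℝ := fun p => u p - φ (p.1, p.2)
  have hwc : Continuous w :=
    huc.sub (hφ.continuous.comp ((NNReal.continuous_coe.comp continuous_fst).prodMk continuous_snd))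
  have hwS : w (S, Y S) = Mu - D := by
    simp [w, φ, hDdef]
    ring
  have hwT : ∀ p : ℝ≥0 × E d, T ≤ p.1 → w p < Mu - D := by
    intro p hp
    have h1 : δ * Real.exp (n * (T - S)) ≤ δ * Real.exp (n * (p.1 - S)) := by gcongr
    have h2 : 0 ≤ K * Real.exp (2 * |L| * p.1) * ‖p.2 - Y p.1‖ ^ 2 := by positivity
    have := hMu p
    simp only [w, φ]
    linarith
  obtain ⟨RY, hRY⟩ := (isCompact_Icc (a := (0 : ℝ)) (b := T)).exists_bound_of_continuousOn
    hYd.continuous.continuousOn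
  set ρ := D / K + 1 with hρ
  have hρ0 : 0 < D / K := by positivity
  have hρD : D < K * ρ ^ 2 := by
    have : D = K * (D / K) := by field_simp
    nlinarith
  have hwR : ∀ p : ℝ≥0 × E d, (p.1 : ℝ) ≤ T → RY + ρ < ‖p.2‖ → w p < Mu - D := by
    intro p hp hp2
    have h1 := hRY p.1 ⟨p.1.2, hp⟩
    have h2 : ρ ≤ ‖p.2 - Y p.1‖ := by linarith [norm_sub_norm_le p.2 (Y p.1)]
    have h3 : (1 : ℝ) ≤ Real.exp (2 * |L| * p.1) := Real.one_le_exp (by positivity)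
    have h4 : K * 1 * ρ ^ 2 ≤ K * Real.exp (2 * |L| * p.1) * ‖p.2 - Y p.1‖ ^ 2 := by gcongr
    have h5 : 0 < δ * Real.exp (n * (p.1 - S)) := by positivity
    have := hMu p
    simp only [w, φ]
    linarith
  have hT0 : 0 ≤ T := hS0'.le.trans hST.le
  have hQ : IsCompact (Icc (0 : ℝ≥0) T.toNNReal ×ˢ Metric.closedBall (0 : E d) (RY + ρ)) :=
    isCompact_Icc.prod (isCompact_closedBall _ _)
  have hSQ : (S, Y S) ∈ Icc (0 : ℝ≥0) T.toNNReal ×ˢ Metric.closedBall (0 : E d) (RY + ρ) := by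
    refine ⟨⟨zero_le, NNReal.le_toNNReal_of_coe_le hST.le⟩, ?_⟩
    rw [mem_closedBall_zero_iff]
    linarith [hRY S ⟨hS0'.le, hST.le⟩]
  obtain ⟨⟨t, x⟩, -, hmaxQ⟩ := hQ.exists_isMaxOn ⟨_, hSQ⟩ hwc.continuousOn
  have hmaxS : Mu - D ≤ w (t, x) := hwS ▸ hmaxQ hSQ
  -- The test in the definition is global, so the maximum on the compact set must be one over all of
  -- `[0, ∞) × ℝ^d`.
  have hmax : ∀ p, w p ≤ w (t, x) := by
    intro p
    by_cases h1 : T ≤ p.1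
    · exact (hwT p h1).le.trans hmaxS
    · by_cases h2 : RY + ρ < ‖p.2‖
      · exact (hwR p (not_le.mp h1).le h2).le.trans hmaxS
      · exact hmaxQ ⟨⟨zero_le, NNReal.le_toNNReal_of_coe_le (not_le.mp h1).le⟩,
          mem_closedBall_zero_iff.mpr (not_lt.mp h2)⟩
  rcases eq_or_lt_of_le (zero_le (a := t)) with ht | ht
  · subst ht
    have h1 := hu.initial x
    have h2 := hKf x
    have h3 : 0 < δ * Real.exp (n * (0 - S)) := by positivity
    simp only [w, φ, NNReal.coe_zero, mul_zero, Real.exp_zero, mul_one] at hmaxS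
    linarith
  · have htT : (t : ℝ) < T := by
      by_contra h
      exact absurd hmaxS (not_le.mpr (hwT (t, x) (not_lt.mp h)))
    have h1 := hu.test φ hφ t x ht (fun p _ => by
      have := hmax p
      simp only [w, mem_ofPred_eq] at this ⊢
      linarith)
    exact absurd h1 (not_le.mpr (hop t ⟨ht, htT⟩ x))

/-- Backward characteristics extend to `C¹` curves on the whole line. -/
theorem IsFlow.exists_backward_curve {b : E d → E d} (hb : Continuous b)
    {X : ℝ → E d → E d} (hX : IsFlow b X) (x : E d) (T : ℝ) :
    ∃ Y : ℝ → E d, ContDiff ℝ 1 Y ∧ (∀ t < T, HasDerivAt Y (-b (Y t)) t) ∧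
      ∀ t ≤ T, Y t = X (T - t) x := by
  -- The orbit is continued to negative times by its tangent line at `x`; this is `C¹`, as a test
  -- function built from the curve requires.
  let Z : ℝ → E d := fun s => X (max s 0) x + min s 0 • b x
  have hZ0 : ∀ s, 0 ≤ s → Z s = X s x := fun s hs => by simp [Z, hs]
  have hZn : ∀ s, s ≤ 0 → Z s = x + s • b x := fun s hs => by simp [Z, hs, (hX x).1]
  have hZ : ∀ s, HasDerivAt Z (b (X (max s 0) x)) s := by
    intro s
    have hpos : ∀ s, 0 ≤ s → HasDerivWithinAt Z (b (X s x)) (Ici 0) s := fun s hs =>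
      ((hX x).2 s hs).congr (fun r hr => hZ0 r hr) (hZ0 s hs)
    have hneg : ∀ s, s ≤ 0 → HasDerivWithinAt Z (b x) (Iic 0) s := fun s hs => by
      have : HasDerivAt (fun s : ℝ => x + s • b x) (b x) s := by
        simpa using ((hasDerivAt_id s).smul_const (b x)).const_add x
      exact this.hasDerivWithinAt.congr (fun r hr => hZn r hr) (hZn s hs)
    rcases lt_trichotomy s 0 with h | h | h
    · rw [max_eq_right h.le, (hX x).1]
      exact (hneg s h.le).hasDerivAt (Iic_mem_nhds h)
    · subst h
      have h1 := hpos 0 le_rfl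
      rw [max_self]
      rw [(hX x).1] at h1 ⊢
      simpa [Ici_union_Iic] using h1.union (hneg 0 le_rfl)
    · rw [max_eq_left h.le]
      exact (hpos s h.le).hasDerivAt (Ici_mem_nhds h)
  have hXc : Continuous (fun s : ℝ => X (max s 0) x) := by
    have : ContinuousOn (fun t : ℝ => X t x) (Ici 0) :=
      fun t ht => ((hX x).2 t ht).continuousWithinAt
    exact this.comp_continuous (by fun_prop) (fun s => le_max_right s 0)
  have hZd : ContDiff ℝ 1 Z := by
    rw [contDiff_one_iff_deriv]
    refine ⟨fun s => (hZ s).differentiableAt, ?_⟩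
    rw [funext fun s => (hZ s).deriv]
    exact hb.comp hXc
  refine ⟨fun t => Z (T - t), hZd.comp (contDiff_const.sub contDiff_id), fun t ht => ?_,
    fun t ht => hZ0 _ (sub_nonneg.mpr ht)⟩
  have h1 : HasDerivAt (fun t : ℝ => T - t) (-1) t := (hasDerivAt_id t).const_sub T
  have h2 := (hZ (T - t)).scomp t h1
  rw [max_eq_left (sub_nonneg.mpr ht.le)] at h2
  rw [← hZ0 _ (sub_nonneg.mpr ht.le), neg_one_smul] at h2
  exact h2

/-- A continuous subsolution lies below the datum transported along the flow. -/
theorem IsViscositySubsolution.le_flow {b : E d → E d} {f : E d → ℝ} {L M : ℝ}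
    (hb : Continuous b) (hL : OneSidedLipschitz L b) (hf : Continuous f) (hM : ∀ x, f x ≤ M)
    {u : ℝ≥0 × E d → ℝ} (hu : IsViscositySubsolution b f u) (huc : Continuous u)
    {X : ℝ → E d → E d} (hX : IsFlow b X) (t : ℝ≥0) (x : E d) : u (t, x) ≤ f (X t x) := by
  rcases eq_or_lt_of_le (zero_le (a := t)) with ht | ht
  · subst ht
    simpa [(hX x).1] using hu.initial x
  · obtain ⟨Y, hYd, hY, hYX⟩ := hX.exists_backward_curve hb x t
    have h0 : Y 0 = X t x := by simpa using hYX 0 t.2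
    have ht1 : Y t = x := by simpa [(hX x).1] using hYX t le_rfl
    have hc : Continuous (fun s : ℝ≥0 => u (s, Y s)) :=
      huc.comp (continuous_id.prodMk (hYd.continuous.comp NNReal.continuous_coe))
    -- The comparison covers only times strictly before the end of the characteristic; continuity of
    -- `u` gives the endpoint.
    have hlim : Tendsto (fun s : ℝ≥0 => u (s, Y s)) (𝓝[<] t) (𝓝 (u (t, x))) := by
      have := (hc.tendsto t).mono_left (nhdsWithin_le_nhds (s := Iio t))
      rwa [ht1] at this
    have hne : (𝓝[<] t).NeBot := nhdsLT_neBot_of_exists_lt ⟨0, ht⟩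
    rw [← h0]
    refine le_of_tendsto hlim ?_
    filter_upwards [Ioo_mem_nhdsLT ht] with s hs
    exact hu.le_of_characteristic hL hf hM huc hYd (fun r hr => hY r hr.2) hs.1
      (NNReal.coe_lt_coe.mpr hs.2)

theorem IsViscositySolution.eq_flow {b : E d → E d} {f : E d → ℝ} {L M : ℝ}
    (hb : Continuous b) (hL : OneSidedLipschitz L b) (hf : Continuous f) (hM : ∀ x, |f x| ≤ M)
    {u : ℝ≥0 × E d → ℝ} (hu : IsViscositySolution b f u) {X : ℝ → E d → E d} (hX : IsFlow b X)
    (t : ℝ≥0) (x : E d) : u (t, x) = f (X t x) := by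
  refine le_antisymm
    (hu.sub.le_flow hb hL hf (fun x => (abs_le.mp (hM x)).2) hu.continuous hX t x) ?_
  have := hu.super.neg.le_flow hb hL hf.fun_neg (M := M)
    (fun x => by linarith [(abs_le.mp (hM x)).1]) hu.continuous.fun_neg hX t x
  linarith

/-! ### Consequences of the hypotheses on `f` and `b` -/

theorem SatisfiesHolder.continuous {f : E d → ℝ} (hf : SatisfiesHolder f) : Continuous f := by
  obtain ⟨C, β, -, hβ, -, h⟩ := hf
  rw [continuous_iff_continuousAt]
  intro x
  rw [ContinuousAt, tendsto_iff_dist_tendsto_zero]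
  refine squeeze_zero (fun _ => dist_nonneg) (fun y => h y x) ?_
  have hc : Continuous (fun y : E d => C * ‖y - x‖ ^ β) :=
    continuous_const.mul (Continuous.rpow_const (by fun_prop) fun _ => Or.inr hβ.le)
  simpa [Real.zero_rpow hβ.ne'] using hc.tendsto x

theorem LipschitzSublinear.continuous_and_oneSidedLipschitz {b : E d → E d}
    (hb : LipschitzSublinear b) : Continuous b ∧ ∃ L, 0 ≤ L ∧ OneSidedLipschitz L b := by
  obtain ⟨C, θ, hC, -, -, -, h⟩ := hb
  refine ⟨(LipschitzWith.of_dist_le_mul (K := C.toNNReal) fun x y => ?_).continuous, C, hC.le,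
    fun x y => ?_⟩
  · rw [dist_eq_norm, dist_eq_norm, Real.coe_toNNReal _ hC.le]
    exact h x y
  · calc _ ≤ ‖b x - b y‖ * ‖x - y‖ := real_inner_le_norm _ _
      _ ≤ C * ‖x - y‖ * ‖x - y‖ := by gcongr; exact h x y
      _ = C * ‖x - y‖ ^ 2 := by ring

end Transport

end

theorem mainTheorem2 (d : ℕ) (hd : 1 ≤ d)
    (b : Transport.E d → Transport.E d) (f : Transport.E d → ℝ)
    (hf_bdd : ∃ M : ℝ, ∀ x, |f x| ≤ M)
    (hf_holder : Transport.SatisfiesHolder f)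
    (hb : Transport.LipschitzSublinear b ∨ Transport.ContinuousDecreasing b) :
    (∃ X : ℝ → Transport.E d → Transport.E d, Transport.IsFlow b X) ∧
    (∃! u : ℝ≥0 × Transport.E d → ℝ, Transport.IsViscositySolution b f u) ∧
    (∀ u : ℝ≥0 × Transport.E d → ℝ, Transport.IsViscositySolution b f u →
      ∀ X : ℝ → Transport.E d → Transport.E d, Transport.IsFlow b X →
        ∀ (t : ℝ≥0) (x : Transport.E d), u (t, x) = f (X t x)) := by
  obtain ⟨M, hM⟩ := hf_bdd
  have hf := hf_holder.continuous
  obtain ⟨hbc, L, hL0, hL⟩ : Continuous b ∧ ∃ L, 0 ≤ L ∧ Transport.OneSidedLipschitz L b := by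
    rcases hb with hb | hb
    · exact hb.continuous_and_oneSidedLipschitz
    · exact ⟨hb.1, 0, le_rfl, fun x y => by simpa using hb.2 x y⟩
  obtain ⟨X, hX⟩ := Transport.exists_isFlow hbc hL0 hL
  exact ⟨⟨X, hX⟩,
    ⟨_, hX.isViscositySolution hL0 hL hf hM, fun u hu => funext fun p =>
      hu.eq_flow hbc hL hf hM hX p.1 p.2⟩,
    fun u hu X hX t x => hu.eq_flow hbc hL hf hM hX t x⟩
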